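/- Let $D=(V,A)$ be a finite digraph; loops, parallel arcs and antiparallel arcs are allowed. For $B\subseteq A$ let $D[B]$ be the subdigraph with arc set $B$ whose vertices are the ends of the arcs in $B$. A digraph is called totally cyclic if each of its (weakly connected) components is strongly connected; in particular $D[\emptyset]$ is totally cyclic. Let $$Q:=\{B\subseteq A \;:\; D[B]\text{ is totally cyclic}\},$$ ordered by inclusion, and let $\mu_Q$ be its Möbius function, i.e. $\mu_Q(X,X)=1$, $\mu_Q(X,Y)=-\sum_{X\subseteq Z\subsetneq Y,\ Z\in Q}\mu_Q(X,Z)$ for $X\subsetneq Y$, and $\mu_Q(X,Y)=0$ if $X\not\subseteq Y$. Then $Q$ is a graded poset: all its maximal chains have the same length, and there is a rank function $rk_Q:Q\to\mathbb{N}$, i.e. a strictly increasing function that is $0$ on minimal elements and satisfies $rk_Q(C)=rk_Q(B)+1$ whenever $C$ covers $B$ in $Q$. Moreover, for every $B\in Q$, $$\mu_Q(\emptyset,B)=(-1)^{rk_Q(B)}.$$ -/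

import Mathlib

/-- A digraph with vertex set `V` and arc set `A`; loops, parallel arcs and antiparallel arcs
are allowed. -/
structure MultiDigraph (V A : Type*) where
  tail : A → V
  head : A → V

namespace MultiDigraph

/-- Some arc leads from `u` to `v`. -/
def Adj {V A : Type*} (D : MultiDigraph V A) (u v : V) : Prop :=
  ∃ a : A, D.tail a = u ∧ D.head a = v

/-- There is a (possibly trivial) directed walk from `u` to `v`. -/
def Reachable {V A : Type*} (D : MultiDigraph V A) (u v : V) : Prop :=
  Relation.ReflTransGen D.Adj u v

/-- `u` and `v` lie in the same component, i.e. they are joined by a walk that may traverse arcs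
in either direction. -/
def SameComponent {V A : Type*} (D : MultiDigraph V A) (u v : V) : Prop :=
  Relation.EqvGen D.Adj u v

/-- Every component is strongly connected. (A directed walk never leaves its component.) -/
def IsTotallyCyclic {V A : Type*} (D : MultiDigraph V A) : Prop :=
  ∀ u v : V, D.SameComponent u v → D.Reachable u v

/-- The subdigraph `D[B]` induced by a set `B` of arcs: its arcs are those in `B`, its vertices
are the ends of the arcs in `B`. -/
def arcInduced {V A : Type*} (D : MultiDigraph V A) (B : Set A) :
    MultiDigraph {v : V // ∃ a ∈ B, D.tail a = v ∨ D.head a = v} B where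
  tail a := ⟨D.tail a, a, a.2, Or.inl rfl⟩
  head a := ⟨D.head a, a, a.2, Or.inr rfl⟩

/-- The poset `Q` of all arc sets `B` with `D[B]` totally cyclic, ordered by inclusion. -/
abbrev Q {V A : Type*} (D : MultiDigraph V A) : Type _ :=
  {B : Set A // (D.arcInduced B).IsTotallyCyclic}

theorem arcInduced_empty_isTotallyCyclic {V A : Type*} (D : MultiDigraph V A) :
    (D.arcInduced ∅).IsTotallyCyclic := by
  rintro ⟨u, a, ha, -⟩
  exact ha.elim

/-- The empty arc set as an element of `Q`. -/
def emptyQ {V A : Type*} (D : MultiDigraph V A) : D.Q :=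
  ⟨∅, D.arcInduced_empty_isTotallyCyclic⟩

noncomputable instance instDecidableEqQ {V A : Type*} (D : MultiDigraph V A) :
    DecidableEq D.Q :=
  Classical.decEq _

/-- Intervals in `Q` are finite when there are finitely many arcs. -/
noncomputable instance instLocallyFiniteOrderQ {V A : Type*} [Finite A]
    (D : MultiDigraph V A) : LocallyFiniteOrder D.Q :=
  LocallyFiniteOrder.ofFiniteIcc fun x y => Set.toFinite (Set.Icc x y)

end MultiDigraph

/-! The members of `Q` are exactly the supports of nonnegative circulations
(`isTotallyCyclic_iff_exists_circulation`). So the interval from `∅` to `B` is the face lattice of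
the cone of nonnegative circulations supported in `B`. The face belonging to `X` has the dimension
of the space of circulations supported in `X`, and this dimension is the rank.

Along a cover the dimension grows by exactly one: a circulation on the larger set that vanishes at
one new arc but not at all of them could be used to build a member of `Q` strictly in between
(`not_covBy_of_circulation`).

For the Möbius function, the defining recursion reduces the claim to the vanishing of the sum of
`(-1) ^ dim` over all faces of the cone when `B ≠ ∅`. This is the Euler relation `eulerSum_eq_zero`,
valid for any polyhedral cone that is not a linear subspace. It is proved by induction on the number
of inequalities. An inequality independent of the others lets faces cancel in pairs. Otherwise there
is a linear dependency; reversing inequalities one at a time, which preserves the relation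
(`eulerSum_flip_eq_zero`), makes its coefficients nonnegative. The dependency then forces one
functional to vanish on the cone, so that inequality becomes an equation. -/

open Module

/-! ### The Euler relation for polyhedral cones. -/

namespace PolyhedralCone

open scoped Classical

variable {ι M : Type*} [AddCommGroup M] [Module ℝ M]

/-- The vectors of `W` at which all functionals `ℓ i` with `i ∈ J` vanish. -/
def vanishing (W : Submodule ℝ M) (ℓ : ι → M →ₗ[ℝ] ℝ) (J : Finset ι) : Submodule ℝ M :=
  W ⊓ ⨅ i ∈ J, LinearMap.ker (ℓ i)

theorem mem_vanishing {W : Submodule ℝ M} {ℓ : ι → M →ₗ[ℝ] ℝ} {J : Finset ι} {x : M} :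
    x ∈ vanishing W ℓ J ↔ x ∈ W ∧ ∀ i ∈ J, ℓ i x = 0 := by
  simp [vanishing]

/-- Some vector of `U` is positive under all functionals `ℓ i` with `i ∈ X`, and its value
under `g` satisfies `r`. -/
def HasPoint (U : Submodule ℝ M) (ℓ : ι → M →ₗ[ℝ] ℝ) (X : Finset ι) (g : M →ₗ[ℝ] ℝ)
    (r : ℝ → Prop) : Prop :=
  ∃ x ∈ U, (∀ i ∈ X, 0 < ℓ i x) ∧ r (g x)

/-- `X` is the set of strict inequalities at some point of the cone
`{x ∈ W | ∀ i ∈ I, 0 ≤ ℓ i x}`. -/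
def IsFace (W : Submodule ℝ M) (ℓ : ι → M →ₗ[ℝ] ℝ) (I X : Finset ι) : Prop :=
  ∃ x ∈ vanishing W ℓ (I \ X), ∀ i ∈ X, 0 < ℓ i x

/-- The sum of `(-1) ^ dim F` over all faces `F` of the cone `{x ∈ W | ∀ i ∈ I, 0 ≤ ℓ i x}`. -/
noncomputable def eulerSum (W : Submodule ℝ M) (ℓ : ι → M →ₗ[ℝ] ℝ) (I : Finset ι) : ℤ :=
  ∑ X ∈ I.powerset, if IsFace W ℓ I X then (-1) ^ finrank ℝ (vanishing W ℓ (I \ X)) else 0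

/-- The cone `{x ∈ W | ∀ i ∈ I, 0 ≤ ℓ i x}` is not a linear subspace. -/
def Nontriv (W : Submodule ℝ M) (ℓ : ι → M →ₗ[ℝ] ℝ) (I : Finset ι) : Prop :=
  ∃ x ∈ W, (∀ i ∈ I, 0 ≤ ℓ i x) ∧ ∃ i ∈ I, 0 < ℓ i x

theorem finrank_inf_ker_add_one [FiniteDimensional ℝ M] {U : Submodule ℝ M} {g : M →ₗ[ℝ] ℝ}
    {y : M} (hy : y ∈ U) (hg : g y ≠ 0) :
    finrank ℝ U = finrank ℝ (U ⊓ LinearMap.ker g : Submodule ℝ M) + 1 := by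
  have h := LinearMap.finrank_range_add_finrank_ker (g.domRestrict U)
  have h1 : LinearMap.range (g.domRestrict U) = ⊤ := by
    apply LinearMap.range_eq_top.2
    apply LinearMap.surjective_of_ne_zero
    intro h0
    exact hg (by simpa using LinearMap.congr_fun h0 ⟨y, hy⟩)
  have h2 : finrank ℝ (LinearMap.ker (g.domRestrict U)) =
      finrank ℝ (U ⊓ LinearMap.ker g : Submodule ℝ M) := by
    have h3 : (LinearMap.ker (g.domRestrict U)).map U.subtype = U ⊓ LinearMap.ker g := by
      ext x
      simp only [Submodule.mem_map, LinearMap.mem_ker, Submodule.mem_inf]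
      constructor
      · rintro ⟨x, hx, rfl⟩
        exact ⟨x.2, hx⟩
      · rintro ⟨hx, hx'⟩
        exact ⟨⟨x, hx⟩, hx', rfl⟩
    rw [← h3]
    exact (LinearEquiv.finrank_eq (Submodule.equivMapOfInjective _ U.injective_subtype _))
  rw [h1, finrank_top, finrank_self, h2] at h
  omega

/-- Positivity on a finite index set survives a small perturbation. -/
theorem exists_pos_perturb (ℓ : ι → M →ₗ[ℝ] ℝ) (X : Finset ι) {x : M}
    (hx : ∀ i ∈ X, 0 < ℓ i x) (y : M) :
    ∃ ε : ℝ, 0 < ε ∧ ∀ i ∈ X, 0 < ℓ i (x + ε • y) := by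
  induction X using Finset.induction_on with
  | empty => exact ⟨1, one_pos, by simp⟩
  | insert a X _ ih =>
    obtain ⟨ε, hε, h⟩ := ih fun i hi => hx i (Finset.mem_insert_of_mem hi)
    have ha := hx a (Finset.mem_insert_self _ _)
    have hd : 0 < ℓ a x / (|ℓ a y| + 1) := by positivity
    have key : ∀ (u v δ : ℝ), 0 < u → 0 < δ → δ * (|v| + 1) ≤ u → 0 < u + δ * v := by
      intro u v δ hu hδ h
      have := neg_abs_le v
      nlinarith
    -- The second bound keeps the change of `ℓ a` below `ℓ a x`; the `+ 1` avoids division by zero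
    -- and makes the inequality strict.
    refine ⟨min ε (ℓ a x / (|ℓ a y| + 1)), lt_min hε hd, ?_⟩
    intro i hi
    rcases Finset.mem_insert.1 hi with rfl | hi
    · simp only [map_add, map_smul, smul_eq_mul]
      refine key _ _ _ ha (lt_min hε hd) ?_
      rw [← le_div_iff₀ (by positivity)]
      exact min_le_right _ _
    · have h1 := h i hi
      have h2 := hx i (Finset.mem_insert_of_mem hi)
      simp only [map_add, map_smul, smul_eq_mul] at h1 ⊢
      set m := min ε (ℓ a x / (|ℓ a y| + 1)) with hm
      have hm0 : 0 < m := lt_min hε hd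
      have hm1 : m ≤ ε := min_le_left _ _
      rcases le_or_gt 0 (ℓ i y) with h3 | h3
      · have := mul_nonneg hm0.le h3
        linarith
      · nlinarith

theorem HasPoint.neg_of_zero {U : Submodule ℝ M} {ℓ : ι → M →ₗ[ℝ] ℝ} {X : Finset ι}
    {g : M →ₗ[ℝ] ℝ} (hz : HasPoint U ℓ X g (· = 0)) {y : M} (hy : y ∈ U) (hg : g y < 0) :
    HasPoint U ℓ X g (· < 0) := by
  obtain ⟨x, hx, hpos, hx0⟩ := hz
  obtain ⟨ε, hε, h⟩ := exists_pos_perturb ℓ X hpos y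
  refine ⟨x + ε • y, U.add_mem hx (U.smul_mem _ hy), h, ?_⟩
  simp only [map_add, map_smul, smul_eq_mul, hx0, zero_add]
  exact mul_neg_of_pos_of_neg hε hg

theorem HasPoint.pos_of_zero {U : Submodule ℝ M} {ℓ : ι → M →ₗ[ℝ] ℝ} {X : Finset ι}
    {g : M →ₗ[ℝ] ℝ} (hz : HasPoint U ℓ X g (· = 0)) {y : M} (hy : y ∈ U) (hg : 0 < g y) :
    HasPoint U ℓ X g (0 < ·) := by
  obtain ⟨x, hx, hpos, hx0⟩ := hz
  obtain ⟨ε, hε, h⟩ := exists_pos_perturb ℓ X hpos y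
  refine ⟨x + ε • y, U.add_mem hx (U.smul_mem _ hy), h, ?_⟩
  simp only [map_add, map_smul, smul_eq_mul, hx0, zero_add]
  exact mul_pos hε hg

theorem HasPoint.zero_of_pos_of_neg {U : Submodule ℝ M} {ℓ : ι → M →ₗ[ℝ] ℝ} {X : Finset ι}
    {g : M →ₗ[ℝ] ℝ} (hp : HasPoint U ℓ X g (0 < ·)) (hn : HasPoint U ℓ X g (· < 0)) :
    HasPoint U ℓ X g (· = 0) := by
  obtain ⟨x, hx, hxp, hx0⟩ := hp
  obtain ⟨y, hy, hyp, hy0⟩ := hn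
  -- The positive combination of `x` and `y` at which `g` cancels.
  refine ⟨(-g y) • x + g x • y, U.add_mem (U.smul_mem _ hx) (U.smul_mem _ hy), fun i hi => ?_, ?_⟩
  · simp only [map_add, map_smul, smul_eq_mul]
    have := mul_pos (neg_pos.2 hy0) (hxp i hi)
    have := mul_pos hx0 (hyp i hi)
    linarith
  · simp only [map_add, map_smul, smul_eq_mul]
    ring

/-- A hyperplane cuts a relatively open cell into pieces with the same total signed count. -/
theorem cell_identity [FiniteDimensional ℝ M] (U : Submodule ℝ M) (ℓ : ι → M →ₗ[ℝ] ℝ)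
    (X : Finset ι) (g : M →ₗ[ℝ] ℝ) :
    (if HasPoint U ℓ X g (0 < ·) then (-1 : ℤ) ^ finrank ℝ U else 0) +
      (if HasPoint U ℓ X g (· < 0) then (-1 : ℤ) ^ finrank ℝ U else 0) +
      (if HasPoint U ℓ X g (· = 0) then
        (-1 : ℤ) ^ finrank ℝ (U ⊓ LinearMap.ker g : Submodule ℝ M) else 0) =
    if ∃ x ∈ U, ∀ i ∈ X, 0 < ℓ i x then (-1 : ℤ) ^ finrank ℝ U else 0 := by
  have hex : (∃ x ∈ U, ∀ i ∈ X, 0 < ℓ i x) ↔ HasPoint U ℓ X g (0 < ·) ∨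
      HasPoint U ℓ X g (· < 0) ∨ HasPoint U ℓ X g (· = 0) := by
    constructor
    · rintro ⟨x, hx, h⟩
      rcases lt_trichotomy (g x) 0 with h0 | h0 | h0
      · exact Or.inr (Or.inl ⟨x, hx, h, h0⟩)
      · exact Or.inr (Or.inr ⟨x, hx, h, h0⟩)
      · exact Or.inl ⟨x, hx, h, h0⟩
    · rintro (⟨x, hx, h, -⟩ | ⟨x, hx, h, -⟩ | ⟨x, hx, h, -⟩) <;> exact ⟨x, hx, h⟩
  -- If the cell crosses the hyperplane, there are two pieces of dimension `d` and one of dimension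
  -- `d - 1`, with total `(-1) ^ d`. In all other nonempty cases a single piece is the whole cell.
  by_cases hz : HasPoint U ℓ X g (· = 0)
  · by_cases hy : ∃ y ∈ U, g y ≠ 0
    · obtain ⟨y, hy, hg⟩ := hy
      have hpn : HasPoint U ℓ X g (0 < ·) ∧ HasPoint U ℓ X g (· < 0) := by
        rcases lt_or_gt_of_ne hg with h | h
        · exact ⟨hz.pos_of_zero (U.neg_mem hy) (by simpa using h), hz.neg_of_zero hy h⟩
        · exact ⟨hz.pos_of_zero hy h, hz.neg_of_zero (U.neg_mem hy) (by simpa using h)⟩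
      rw [if_pos (hex.2 (Or.inl hpn.1)), if_pos hpn.1, if_pos hpn.2, if_pos hz,
        finrank_inf_ker_add_one hy hg, pow_succ]
      ring
    · push Not at hy
      have h1 : U ⊓ LinearMap.ker g = U := inf_eq_left.2 fun y h => hy y h
      have h2 : ¬ HasPoint U ℓ X g (0 < ·) := fun ⟨x, hx, _, h⟩ => by simp [hy x hx] at h
      have h3 : ¬ HasPoint U ℓ X g (· < 0) := fun ⟨x, hx, _, h⟩ => by simp [hy x hx] at h
      rw [if_pos (hex.2 (Or.inr (Or.inr hz))), if_pos hz, if_neg h2, if_neg h3, h1]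
      ring
  · by_cases hp : HasPoint U ℓ X g (0 < ·)
    · have hn : ¬ HasPoint U ℓ X g (· < 0) := fun hn => hz (hp.zero_of_pos_of_neg hn)
      rw [if_pos hp, if_neg hn, if_neg hz, if_pos (hex.2 (Or.inl hp))]
      ring
    · by_cases hn : HasPoint U ℓ X g (· < 0)
      · rw [if_neg hp, if_pos hn, if_neg hz, if_pos (hex.2 (Or.inr (Or.inl hn)))]
        ring
      · rw [if_neg hp, if_neg hn, if_neg hz,
          if_neg fun h => (hex.1 h).elim hp fun h => h.elim hn hz]
        ring

theorem vanishing_insert (W : Submodule ℝ M) (ℓ : ι → M →ₗ[ℝ] ℝ) (J : Finset ι) (e : ι) :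
    vanishing W ℓ (insert e J) = vanishing W ℓ J ⊓ LinearMap.ker (ℓ e) := by
  ext x
  simp only [mem_vanishing, Finset.forall_mem_insert, Submodule.mem_inf, LinearMap.mem_ker]
  tauto

theorem vanishing_inf_ker (W : Submodule ℝ M) (ℓ : ι → M →ₗ[ℝ] ℝ) (J : Finset ι)
    (g : M →ₗ[ℝ] ℝ) :
    vanishing (W ⊓ LinearMap.ker g) ℓ J = vanishing W ℓ J ⊓ LinearMap.ker g := by
  ext x
  simp only [mem_vanishing, Submodule.mem_inf, LinearMap.mem_ker]
  tauto

theorem eulerSum_inf_ker (W : Submodule ℝ M) (ℓ : ι → M →ₗ[ℝ] ℝ) (I : Finset ι)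
    (g : M →ₗ[ℝ] ℝ) :
    eulerSum (W ⊓ LinearMap.ker g) ℓ I =
      ∑ X ∈ I.powerset, if HasPoint (vanishing W ℓ (I \ X)) ℓ X g (· = 0) then
        (-1 : ℤ) ^ finrank ℝ (vanishing W ℓ (I \ X) ⊓ LinearMap.ker g : Submodule ℝ M) else 0 := by
  unfold eulerSum
  refine Finset.sum_congr rfl fun X _ => ?_
  rw [vanishing_inf_ker]
  refine if_congr ?_ rfl rfl
  unfold IsFace HasPoint
  rw [vanishing_inf_ker]
  constructor
  · rintro ⟨x, hx, h⟩
    exact ⟨x, hx.1, h, hx.2⟩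
  · rintro ⟨x, hx, h, h0⟩
    exact ⟨x, ⟨hx, h0⟩, h⟩

/-- Faces are sorted by whether `ℓ e` is tight: the tight ones are the faces of the hyperplane
section, the others are the parts with `0 < ℓ e` of the open cells of the cone given by `I`. -/
theorem eulerSum_insert (W : Submodule ℝ M) (ℓ : ι → M →ₗ[ℝ] ℝ) {I : Finset ι} {e : ι}
    (he : e ∉ I) :
    eulerSum W ℓ (insert e I) = eulerSum (W ⊓ LinearMap.ker (ℓ e)) ℓ I +
      ∑ X ∈ I.powerset, if HasPoint (vanishing W ℓ (I \ X)) ℓ X (ℓ e) (0 < ·) then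
        (-1 : ℤ) ^ finrank ℝ (vanishing W ℓ (I \ X)) else 0 := by
  rw [eulerSum_inf_ker]
  unfold eulerSum
  rw [Finset.sum_powerset_insert he]
  congr 1
  · refine Finset.sum_congr rfl fun X hX => ?_
    have heX : e ∉ X := fun h => he (Finset.mem_powerset.1 hX h)
    have h1 : vanishing W ℓ (insert e I \ X) = vanishing W ℓ (I \ X) ⊓ LinearMap.ker (ℓ e) := by
      rw [Finset.insert_sdiff_of_notMem _ heX, ← vanishing_insert]
    rw [h1]
    refine if_congr ?_ rfl rfl
    unfold IsFace HasPoint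
    rw [h1]
    constructor
    · rintro ⟨x, hx, h⟩
      exact ⟨x, hx.1, h, hx.2⟩
    · rintro ⟨x, hx, h, h0⟩
      exact ⟨x, ⟨hx, h0⟩, h⟩
  · refine Finset.sum_congr rfl fun X hX => ?_
    have h1 : (insert e I) \ (insert e X) = I \ X := by
      ext i
      simp only [Finset.mem_sdiff, Finset.mem_insert]
      constructor
      · tauto
      · rintro ⟨hi, hx⟩
        refine ⟨Or.inr hi, ?_⟩
        rintro (rfl | h)
        exacts [he hi, hx h]
    rw [h1]
    refine if_congr ?_ rfl rfl
    unfold IsFace HasPoint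
    rw [h1]
    simp only [Finset.forall_mem_insert]
    exact exists_congr fun x => and_congr_right fun _ => and_comm

theorem vanishing_congr {ℓ ℓ' : ι → M →ₗ[ℝ] ℝ} {J : Finset ι} (h : ∀ i ∈ J, ℓ i = ℓ' i)
    (W : Submodule ℝ M) : vanishing W ℓ J = vanishing W ℓ' J := by
  ext x
  simp only [mem_vanishing]
  refine and_congr_right fun _ => forall₂_congr fun i hi => ?_
  rw [h i hi]

theorem eulerSum_congr {ℓ ℓ' : ι → M →ₗ[ℝ] ℝ} {I : Finset ι} (h : ∀ i ∈ I, ℓ i = ℓ' i)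
    (W : Submodule ℝ M) : eulerSum W ℓ I = eulerSum W ℓ' I := by
  unfold eulerSum
  refine Finset.sum_congr rfl fun X hX => ?_
  have h1 : vanishing W ℓ (I \ X) = vanishing W ℓ' (I \ X) :=
    vanishing_congr (fun i hi => h i (Finset.mem_sdiff.1 hi).1) W
  have h2 : IsFace W ℓ I X ↔ IsFace W ℓ' I X := by
    unfold IsFace
    rw [h1]
    refine exists_congr fun x => and_congr_right fun _ => forall₂_congr fun i hi => ?_
    rw [h i (Finset.mem_powerset.1 hX hi)]
  rw [h1]
  exact if_congr h2 rfl rfl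

theorem IsFace.nontriv {W : Submodule ℝ M} {ℓ : ι → M →ₗ[ℝ] ℝ} {I X : Finset ι}
    (h : IsFace W ℓ I X) (hX : X ⊆ I) (hne : X.Nonempty) : Nontriv W ℓ I := by
  obtain ⟨x, hx, hpos⟩ := h
  rw [mem_vanishing] at hx
  obtain ⟨j, hj⟩ := hne
  refine ⟨x, hx.1, fun i hi => ?_, j, hX hj, hpos j hj⟩
  by_cases hiX : i ∈ X
  · exact (hpos i hiX).le
  · exact (hx.2 i (Finset.mem_sdiff.2 ⟨hi, hiX⟩)).ge

/-- A cone that is a linear subspace has itself as its only face. -/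
theorem eulerSum_of_not_nontriv {W : Submodule ℝ M} {ℓ : ι → M →ₗ[ℝ] ℝ} {I : Finset ι}
    (h : ¬ Nontriv W ℓ I) : eulerSum W ℓ I = (-1) ^ finrank ℝ (vanishing W ℓ I) := by
  unfold eulerSum
  rw [Finset.sum_eq_single ∅]
  · rw [if_pos ⟨0, Submodule.zero_mem _, by simp⟩, Finset.sdiff_empty]
  · intro X hX hne
    exact if_neg fun hf =>
      h (hf.nontriv (Finset.mem_powerset.1 hX) (Finset.nonempty_iff_ne_empty.2 hne))
  · simp

/-- Reversing the inequality `0 ≤ ℓ e`. -/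
noncomputable def flip (ℓ : ι → M →ₗ[ℝ] ℝ) (e : ι) : ι → M →ₗ[ℝ] ℝ :=
  Function.update ℓ e (-ℓ e)

@[simp] theorem flip_self (ℓ : ι → M →ₗ[ℝ] ℝ) (e : ι) : flip ℓ e e = -ℓ e := by
  simp [flip]

theorem flip_of_ne (ℓ : ι → M →ₗ[ℝ] ℝ) {e i : ι} (h : i ≠ e) : flip ℓ e i = ℓ i := by
  simp [flip, h]

theorem flip_flip (ℓ : ι → M →ₗ[ℝ] ℝ) (e : ι) : flip (flip ℓ e) e = ℓ := by
  simp [flip]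

/-- The hyperplane `ℓ e = 0` cuts the cone given by `I` into two halves sharing the section.
Applying `cell_identity` to every cell gives inclusion-exclusion. -/
theorem eulerSum_add_flip [FiniteDimensional ℝ M] (W : Submodule ℝ M) (ℓ : ι → M →ₗ[ℝ] ℝ)
    {I : Finset ι} {e : ι} (he : e ∉ I) :
    eulerSum W ℓ (insert e I) + eulerSum W (flip ℓ e) (insert e I) =
      eulerSum W ℓ I + eulerSum (W ⊓ LinearMap.ker (ℓ e)) ℓ I := by
  have hne : ∀ i ∈ I, flip ℓ e i = ℓ i := fun i hi => flip_of_ne ℓ (by rintro rfl; exact he hi)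
  have hker : LinearMap.ker (-ℓ e) = LinearMap.ker (ℓ e) := by ext; simp
  rw [eulerSum_insert W ℓ he, eulerSum_insert W (flip ℓ e) he, flip_self, hker,
    eulerSum_congr hne]
  have h2 : ∑ X ∈ I.powerset, (if HasPoint (vanishing W (flip ℓ e) (I \ X)) (flip ℓ e) X
      (-ℓ e) (0 < ·) then (-1 : ℤ) ^ finrank ℝ (vanishing W (flip ℓ e) (I \ X)) else 0) =
      ∑ X ∈ I.powerset, if HasPoint (vanishing W ℓ (I \ X)) ℓ X (ℓ e) (· < 0) then
        (-1 : ℤ) ^ finrank ℝ (vanishing W ℓ (I \ X)) else 0 := by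
    refine Finset.sum_congr rfl fun X hX => ?_
    rw [vanishing_congr (fun i hi => hne i (Finset.mem_sdiff.1 hi).1) W]
    refine if_congr ?_ rfl rfl
    unfold HasPoint
    refine exists_congr fun x => and_congr_right fun _ => and_congr ?_ (by simp)
    refine forall₂_congr fun i hi => ?_
    rw [hne i (Finset.mem_powerset.1 hX hi)]
  have h3 : eulerSum W ℓ I = ∑ X ∈ I.powerset,
      if ∃ x ∈ vanishing W ℓ (I \ X), ∀ i ∈ X, 0 < ℓ i x then
        (-1 : ℤ) ^ finrank ℝ (vanishing W ℓ (I \ X)) else 0 := rfl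
  rw [h2, h3, eulerSum_inf_ker]
  simp only [← cell_identity _ ℓ _ (ℓ e), Finset.sum_add_distrib]
  ring

/-- In `eulerSum_add_flip` the three terms other than the flipped one must cancel. If the section is
not linear, all three vanish. If it is linear, exactly one of the uncut cone and the unflipped half
is linear too, and its sign cancels against that of the section. -/
theorem eulerSum_flip_eq_zero [FiniteDimensional ℝ M] {W : Submodule ℝ M}
    {ℓ : ι → M →ₗ[ℝ] ℝ} {I : Finset ι} {e : ι} (he : e ∉ I)
    (h' : Nontriv W ℓ I → eulerSum W ℓ I = 0)
    (h₀ : Nontriv (W ⊓ LinearMap.ker (ℓ e)) ℓ I →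
      eulerSum (W ⊓ LinearMap.ker (ℓ e)) ℓ I = 0)
    (h : Nontriv W ℓ (insert e I) → eulerSum W ℓ (insert e I) = 0)
    (hn : Nontriv W (flip ℓ e) (insert e I)) : eulerSum W (flip ℓ e) (insert e I) = 0 := by
  have hne : ∀ i ∈ I, flip ℓ e i = ℓ i := fun i hi => flip_of_ne ℓ (by rintro rfl; exact he hi)
  have key := eulerSum_add_flip W ℓ he
  obtain ⟨x, hxW, hx, j, hj, hxj⟩ := hn
  rw [Finset.forall_mem_insert, flip_self] at hx
  have hxe : ℓ e x ≤ 0 := by simpa using hx.1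
  have hxI : ∀ i ∈ I, 0 ≤ ℓ i x := fun i hi => by rw [← hne i hi]; exact hx.2 i hi
  have hlin : vanishing W ℓ (insert e I) = vanishing (W ⊓ LinearMap.ker (ℓ e)) ℓ I := by
    rw [vanishing_insert, vanishing_inf_ker]
  by_cases n0 : Nontriv (W ⊓ LinearMap.ker (ℓ e)) ℓ I
  · obtain ⟨y, hyW, hy, k, hk, hyk⟩ := n0
    have hye : ℓ e y = 0 := hyW.2
    have n' : Nontriv W ℓ I := ⟨y, hyW.1, hy, k, hk, hyk⟩
    have n : Nontriv W ℓ (insert e I) :=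
      ⟨y, hyW.1, (Finset.forall_mem_insert ..).2 ⟨hye.ge, hy⟩, k, Finset.mem_insert_of_mem hk, hyk⟩
    rw [h n, h' n', h₀ ⟨y, hyW, hy, k, hk, hyk⟩] at key
    linarith
  · by_cases n : Nontriv W ℓ (insert e I)
    · obtain ⟨y, hyW, hy, k, hk, hyk⟩ := n
      rw [Finset.forall_mem_insert] at hy
      have hye : 0 < ℓ e y := by
        refine lt_of_le_of_ne hy.1 fun h0 => n0 ⟨y, ⟨hyW, h0.symm⟩, hy.2, ?_⟩
        rcases Finset.mem_insert.1 hk with rfl | hk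
        · exact absurd h0 hyk.ne
        · exact ⟨k, hk, hyk⟩
      have hxe' : ℓ e x < 0 := by
        refine lt_of_le_of_ne hxe fun h0 => n0 ⟨x, ⟨hxW, h0⟩, hxI, ?_⟩
        rcases Finset.mem_insert.1 hj with rfl | hj
        · simp [h0] at hxj
        · exact ⟨j, hj, by rwa [hne j hj] at hxj⟩
      -- Otherwise the positive combination of `y` and `x` lying on `ℓ e = 0` would make the section
      -- nontrivial.
      have hyI : ∀ i ∈ I, ℓ i y = 0 := by
        by_contra! hcon
        obtain ⟨i, hi, hiy⟩ := hcon
        have hiy' : 0 < ℓ i y := lt_of_le_of_ne (hy.2 i hi) (Ne.symm hiy)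
        refine n0 ⟨(-ℓ e x) • y + ℓ e y • x,
          ⟨W.add_mem (W.smul_mem _ hyW) (W.smul_mem _ hxW), ?_⟩, fun i hi => ?_, i, hi, ?_⟩
        · simp only [SetLike.mem_coe, LinearMap.mem_ker, map_add, map_smul, smul_eq_mul]
          ring
        · have h1 := mul_nonneg (neg_pos.2 hxe').le (hy.2 i hi)
          have h2 := mul_nonneg hye.le (hxI i hi)
          simp only [map_add, map_smul, smul_eq_mul]
          linarith
        · have h1 := mul_pos (neg_pos.2 hxe') hiy'
          have h2 := mul_nonneg hye.le (hxI i hi)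
          simp only [map_add, map_smul, smul_eq_mul]
          linarith
      have n' : ¬ Nontriv W ℓ I := by
        rintro ⟨z, hzW, hz, k, hk, hzk⟩
        have hval : ∀ i ∈ I, ℓ i (z - (ℓ e z / ℓ e y) • y) = ℓ i z := fun i hi => by
          simp [hyI i hi]
        -- Projection along `y` onto `ℓ e = 0`; it leaves every `ℓ i` with `i ∈ I` unchanged.
        refine n0 ⟨z - (ℓ e z / ℓ e y) • y, ⟨W.sub_mem hzW (W.smul_mem _ hyW), ?_⟩,
          fun i hi => ?_, k, hk, ?_⟩
        · simp [hye.ne']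
        · rw [hval i hi]
          exact hz i hi
        · rwa [hval k hk]
      have hdim := finrank_inf_ker_add_one (mem_vanishing.2 ⟨hyW, hyI⟩) hye.ne'
      rw [h ⟨y, hyW, (Finset.forall_mem_insert ..).2 hy, k, hk, hyk⟩,
        eulerSum_of_not_nontriv n', eulerSum_of_not_nontriv n0, vanishing_inf_ker, hdim,
        pow_succ] at key
      linarith
    · have n' : Nontriv W ℓ I := by
        refine ⟨x, hxW, hxI, ?_⟩
        by_contra! hcon
        have hx0 : ∀ i ∈ I, ℓ i x = 0 := fun i hi => le_antisymm (hcon i hi) (hxI i hi)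
        have hje : j = e := by
          rcases Finset.mem_insert.1 hj with rfl | hj
          · rfl
          · rw [hne j hj, hx0 j hj] at hxj
            exact absurd hxj (lt_irrefl _)
        subst hje
        rw [flip_self] at hxj
        refine n ⟨-x, W.neg_mem hxW, (Finset.forall_mem_insert ..).2 ⟨?_, fun i hi => ?_⟩, j, hj, ?_⟩
        · simpa using hxe
        · simp [hx0 i hi]
        · simpa using hxj
      rw [eulerSum_of_not_nontriv n, eulerSum_of_not_nontriv n0, h' n', hlin] at key
      linarith

/-- Moving along `v` changes `ℓ e` freely and nothing else, so each cell that reaches `0 < ℓ e` also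
reaches `ℓ e = 0` and conversely. The two resulting faces differ by one in dimension and cancel. -/
theorem eulerSum_insert_eq_zero_of_dual [FiniteDimensional ℝ M] {W : Submodule ℝ M}
    {ℓ : ι → M →ₗ[ℝ] ℝ} {I : Finset ι} {e : ι} (he : e ∉ I) {v : M} (hv : v ∈ W)
    (hve : ℓ e v ≠ 0) (hvI : ∀ i ∈ I, ℓ i v = 0) : eulerSum W ℓ (insert e I) = 0 := by
  rw [eulerSum_insert W ℓ he, eulerSum_inf_ker, ← Finset.sum_add_distrib]
  refine Finset.sum_eq_zero fun X hX => ?_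
  have hX := Finset.mem_powerset.1 hX
  have hvU : v ∈ vanishing W ℓ (I \ X) :=
    mem_vanishing.2 ⟨hv, fun i hi => hvI i (Finset.mem_sdiff.1 hi).1⟩
  have shift : ∀ (r s : ℝ → Prop) (b : ℝ), s b →
      HasPoint (vanishing W ℓ (I \ X)) ℓ X (ℓ e) r →
      HasPoint (vanishing W ℓ (I \ X)) ℓ X (ℓ e) s := by
    rintro r s b hb ⟨x, hx, hpos, -⟩
    refine ⟨x + ((b - ℓ e x) / ℓ e v) • v,
      Submodule.add_mem _ hx (Submodule.smul_mem _ _ hvU), fun i hi => ?_, ?_⟩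
    · simpa [hvI i (hX hi)] using hpos i hi
    · simpa [hve] using hb
  have hiff : HasPoint (vanishing W ℓ (I \ X)) ℓ X (ℓ e) (0 < ·) ↔
      HasPoint (vanishing W ℓ (I \ X)) ℓ X (ℓ e) (· = 0) :=
    ⟨shift _ _ 0 rfl, shift _ _ 1 one_pos⟩
  rw [if_congr hiff rfl rfl, finrank_inf_ker_add_one hvU hve, pow_succ]
  split_ifs <;> ring

/-- A constraint that vanishes on the whole cone can be turned into an equation. -/
theorem eulerSum_eq_of_vanishes {W : Submodule ℝ M}
    {ℓ : ι → M →ₗ[ℝ] ℝ} {I : Finset ι} {e : ι} (he : e ∉ I)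
    (h : ∀ x ∈ W, (∀ i ∈ insert e I, 0 ≤ ℓ i x) → ℓ e x = 0) :
    eulerSum W ℓ (insert e I) = eulerSum (W ⊓ LinearMap.ker (ℓ e)) ℓ I := by
  rw [eulerSum_insert W ℓ he, add_eq_left]
  refine Finset.sum_eq_zero fun X hX => if_neg ?_
  rintro ⟨x, hx, hpos, hxe⟩
  rw [mem_vanishing] at hx
  refine hxe.ne' (h x hx.1 ((Finset.forall_mem_insert ..).2 ⟨hxe.le, fun i hi => ?_⟩))
  by_cases hiX : i ∈ X
  · exact (hpos i hiX).le
  · exact (hx.2 i (Finset.mem_sdiff.2 ⟨hi, hiX⟩)).ge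

/-- A constraint that is not determined by the others has a dual vector, otherwise it is a
linear combination of them. -/
theorem exists_dual_or_dependent (W : Submodule ℝ M) (ℓ : ι → M →ₗ[ℝ] ℝ) (I : Finset ι) (e : ι) :
    (∃ v ∈ W, ℓ e v ≠ 0 ∧ ∀ i ∈ I, ℓ i v = 0) ∨
      ∃ c : ι → ℝ, ∀ x ∈ W, ℓ e x = ∑ i ∈ I, c i * ℓ i x := by
  by_cases h : ∃ v ∈ W, ℓ e v ≠ 0 ∧ ∀ i ∈ I, ℓ i v = 0
  · exact Or.inl h
  · right
    have hspan := mem_span_of_iInf_ker_le_ker (ι := I)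
      (L := fun i => (ℓ i).domRestrict W) (K := (ℓ e).domRestrict W) (by
        intro x hx
        by_contra hxe
        refine h ⟨x, x.2, hxe, fun i hi => ?_⟩
        have := (Submodule.mem_iInf _).1 hx ⟨i, hi⟩
        simpa using this)
    obtain ⟨c, hc⟩ := (Submodule.mem_span_range_iff_exists_fun ℝ).1 hspan
    refine ⟨fun i => if hi : i ∈ I then c ⟨i, hi⟩ else 0, fun x hx => ?_⟩
    have := LinearMap.congr_fun hc ⟨x, hx⟩
    rw [← Finset.sum_coe_sort]
    simpa using this.symm

/-- The Euler relation for the faces of a polyhedral cone, assuming it for cones with fewer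
constraints and a linear dependency between the constraints. -/
theorem eulerSum_eq_zero_of_dependent [FiniteDimensional ℝ M] {I : Finset ι}
    (ih : ∀ i ∈ I, ∀ (W : Submodule ℝ M) (ℓ : ι → M →ₗ[ℝ] ℝ),
      Nontriv W ℓ (I.erase i) → eulerSum W ℓ (I.erase i) = 0)
    (W : Submodule ℝ M) {e : ι} (he : e ∈ I) (T : Finset ι) :
    ∀ (ℓ : ι → M →ₗ[ℝ] ℝ) (c : ι → ℝ), c e ≠ 0 → (∀ i ∈ I, c i < 0 → i ∈ T) →
      (∀ x ∈ W, ∑ i ∈ I, c i * ℓ i x = 0) → Nontriv W ℓ I → eulerSum W ℓ I = 0 := by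
  induction T using Finset.induction_on with
  | empty =>
    intro ℓ c hce hc hdep hn
    -- No negative coefficient is left, so on the cone the dependency is a vanishing sum of
    -- nonnegative terms; as `c e ≠ 0`, this gives `ℓ e = 0`.
    have hc0 : ∀ i ∈ I, 0 ≤ c i := fun i hi => not_lt.1 fun h => by simpa using hc i hi h
    have hvan : ∀ x ∈ W, (∀ i ∈ I, 0 ≤ ℓ i x) → ℓ e x = 0 := by
      intro x hx hpos
      have := (Finset.sum_eq_zero_iff_of_nonneg
        fun i hi => mul_nonneg (hc0 i hi) (hpos i hi)).1 (hdep x hx) e he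
      exact (mul_eq_zero.1 this).resolve_left hce
    have hI := Finset.insert_erase he
    have h1 := eulerSum_eq_of_vanishes (W := W) (ℓ := ℓ) (Finset.notMem_erase e I)
      (by rwa [hI])
    rw [hI] at h1
    rw [h1]
    obtain ⟨x, hxW, hx, j, hj, hxj⟩ := hn
    have hxe := hvan x hxW hx
    refine ih e he _ ℓ ⟨x, ⟨hxW, hxe⟩, fun i hi => hx i (Finset.mem_of_mem_erase hi), j,
      Finset.mem_erase.2 ⟨?_, hj⟩, hxj⟩
    rintro rfl
    exact hxj.ne' hxe
  | insert a T _ ihT =>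
    intro ℓ c hce hc hdep hn
    by_cases ha : a ∈ I ∧ c a < 0
    · have hI := Finset.insert_erase ha.1
      have hflip : Nontriv W (flip ℓ a) I → eulerSum W (flip ℓ a) I = 0 := by
        -- Changing the signs of both `ℓ a` and `c a` preserves the dependency and removes one
        -- negative coefficient.
        refine ihT (flip ℓ a) (Function.update c a (-c a)) ?_ ?_ ?_
        · by_cases hea : e = a
          · subst hea
            simpa using hce
          · simpa [hea] using hce
        · intro i hi hci
          by_cases hia : i = a
          · subst hia
            rw [Function.update_self] at hci
            linarith [ha.2]
          · rw [Function.update_of_ne hia] at hci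
            exact (Finset.mem_insert.1 (hc i hi hci)).resolve_left hia
        · intro x hx
          rw [← hdep x hx]
          refine Finset.sum_congr rfl fun i _ => ?_
          by_cases hia : i = a
          · subst hia
            simp
          · rw [Function.update_of_ne hia, flip_of_ne _ hia]
      have := eulerSum_flip_eq_zero (W := W) (ℓ := flip ℓ a) (Finset.notMem_erase a I)
        (ih a ha.1 _ _) (ih a ha.1 _ _)
      rw [hI, flip_flip] at this
      exact this hflip hn
    · refine ihT ℓ c hce (fun i hi hci => ?_) hdep hn
      refine (Finset.mem_insert.1 (hc i hi hci)).resolve_left ?_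
      rintro rfl
      exact ha ⟨hi, hci⟩

/-- The Euler relation: the faces of a polyhedral cone that is not a linear subspace, counted with
the sign `(-1) ^ dim`, add up to zero. -/
theorem eulerSum_eq_zero [FiniteDimensional ℝ M] (I : Finset ι) :
    ∀ (W : Submodule ℝ M) (ℓ : ι → M →ₗ[ℝ] ℝ), Nontriv W ℓ I → eulerSum W ℓ I = 0 := by
  induction I using Finset.strongInduction with
  | H I ih =>
    intro W ℓ hn
    obtain ⟨e, he⟩ : I.Nonempty := by
      obtain ⟨_, _, _, j, hj, _⟩ := hn
      exact ⟨j, hj⟩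
    have hI := Finset.insert_erase he
    rcases exists_dual_or_dependent W ℓ (I.erase e) e with ⟨v, hv, hve, hvI⟩ | ⟨c, hc⟩
    · have := eulerSum_insert_eq_zero_of_dual (Finset.notMem_erase e I) hv hve hvI
      rwa [hI] at this
    · refine eulerSum_eq_zero_of_dependent (fun i hi => ih _ (Finset.erase_ssubset hi)) W he I ℓ
        (Function.update c e (-1)) (by simp) (fun i hi _ => hi) (fun x hx => ?_) hn
      rw [← Finset.add_sum_erase _ _ he, Function.update_self, hc x hx, neg_one_mul,
        neg_add_eq_zero]
      refine Finset.sum_congr rfl fun i hi => ?_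
      rw [Function.update_of_ne (Finset.ne_of_mem_erase hi)]

end PolyhedralCone

/-! ### Maximal chains and Möbius functions from a rank function. -/

/-- The rank is injective on a chain, and on a maximal one it takes every value from `0` to `r top`:
the neighbours of a skipped value would form a cover along which `r` jumps by at least two. -/
theorem IsMaxChain.ncard_eq_of_covBy {α : Type*} [PartialOrder α] [Finite α] {r : α → ℕ}
    (hr : StrictMono r) (hcov : ∀ a b, a ⋖ b → r b = r a + 1) {bot top : α}
    (hbot : ∀ x, bot ≤ x) (htop : ∀ x, x ≤ top) (h0 : r bot = 0) {c : Set α}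
    (hc : IsMaxChain (· ≤ ·) c) : c.ncard = r top + 1 := by
  have hmem : ∀ x, (∀ y ∈ c, x ≤ y ∨ y ≤ x) → x ∈ c := by
    intro x hx
    have h1 : IsChain (· ≤ ·) (insert x c) := hc.1.insert fun y hy _ => hx y hy
    have := hc.2 h1 (Set.subset_insert x c)
    rw [this]
    exact Set.mem_insert x c
  have hb : bot ∈ c := hmem bot fun y _ => Or.inl (hbot y)
  have ht : top ∈ c := hmem top fun y _ => Or.inr (htop y)
  have hlt : ∀ x ∈ c, ∀ y ∈ c, r x < r y → x < y := by
    intro x hx y hy hxy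
    rcases hc.1.total hx hy with h | h
    · exact lt_of_le_of_ne h (by rintro rfl; exact hxy.false)
    · exact absurd (hr.monotone h) (not_le.2 hxy)
  have hinj : Set.InjOn r c := by
    intro x hx y hy hxy
    rcases hc.1.total hx hy with h | h
    · exact h.eq_of_not_lt fun hl => (hr hl).ne hxy
    · exact (h.eq_of_not_lt fun hl => (hr hl).ne hxy.symm).symm
  have himg : r '' c = Set.Iio (r top + 1) := by
    ext k
    simp only [Set.mem_image, Set.mem_Iio, Nat.lt_succ_iff]
    constructor
    · rintro ⟨x, -, rfl⟩
      exact hr.monotone (htop x)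
    · intro hk
      by_contra! hno
      obtain ⟨b, hbm, hbmax⟩ := Set.exists_max_image {x ∈ c | r x < k} r (Set.toFinite _)
        ⟨bot, hb, lt_of_le_of_ne (by omega) (hno bot hb)⟩
      obtain ⟨d, hdm, hdmin⟩ := Set.exists_min_image {x ∈ c | k < r x} r (Set.toFinite _)
        ⟨top, ht, lt_of_le_of_ne hk (hno top ht).symm⟩
      have hbd : b ⋖ d := by
        refine ⟨hlt b hbm.1 d hdm.1 (hbm.2.trans hdm.2), fun x hbx hxd => ?_⟩
        have hxc : x ∈ c := by
          refine hmem x fun y hy => ?_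
          rcases lt_or_gt_of_ne (hno y hy) with hyk | hyk
          · right
            refine le_trans ?_ hbx.le
            rcases hc.1.total hy hbm.1 with h | h
            · exact h
            · exact (hinj hy hbm.1 (le_antisymm (hbmax y ⟨hy, hyk⟩) (hr.monotone h))).le
          · left
            refine le_trans hxd.le ?_
            rcases hc.1.total hdm.1 hy with h | h
            · exact h
            · exact (hinj hdm.1 hy (le_antisymm (hdmin y ⟨hy, hyk⟩) (hr.monotone h))).le
        rcases lt_or_gt_of_ne (hno x hxc) with hxk | hxk
        · exact absurd (hr hbx) (not_lt.2 (hbmax x ⟨hxc, hxk⟩))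
        · exact absurd (hr hxd) (not_lt.2 (hdmin x ⟨hxc, hxk⟩))
      have h1 := hcov b d hbd
      have h2 := hbm.2
      have h3 := hdm.2
      omega
  rw [← hinj.ncard_image, himg, Set.ncard_eq_toFinset_card']
  simp

theorem IncidenceAlgebra.mu_eq_of_sum_Icc_eq_zero {α : Type*} [PartialOrder α]
    [LocallyFiniteOrder α] [DecidableEq α] [Finite α] {bot : α} (hbot : ∀ x, bot ≤ x) {s : α → ℤ}
    (h0 : s bot = 1) (hs : ∀ b, b ≠ bot → ∑ x ∈ Finset.Icc bot b, s x = 0) (b : α) :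
    IncidenceAlgebra.mu ℤ bot b = s b := by
  induction b using WellFoundedLT.induction with
  | ind b ih =>
    by_cases hb : b = bot
    · subst hb
      rw [IncidenceAlgebra.mu_self, h0]
    · have h1 := hs b hb
      rw [← Finset.Ico_insert_right (hbot b), Finset.sum_insert Finset.right_notMem_Ico] at h1
      rw [IncidenceAlgebra.mu_eq_neg_sum_Ico_of_ne (Ne.symm hb),
        Finset.sum_congr rfl fun x hx => ih x (Finset.mem_Ico.1 hx).2]
      linarith

/-! ### Circulations and total cyclicity. -/

namespace MultiDigraph

open scoped Classical

theorem emptyQ_le {V A : Type*} (D : MultiDigraph V A) (B : D.Q) : D.emptyQ ≤ B := Set.empty_subset B.1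

variable {V A : Type*} [Fintype A]

/-- The circulations of `D` that vanish outside `B`, given by orthogonality to all potential
differences. -/
def circulations (D : MultiDigraph V A) (B : Set A) : Submodule ℝ (A → ℝ) where
  carrier := {f | (∀ p : V → ℝ, ∑ a, f a * (p (D.head a) - p (D.tail a)) = 0) ∧ ∀ a ∉ B, f a = 0}
  zero_mem' := by simp
  add_mem' := by
    rintro f g ⟨hf, hf'⟩ ⟨hg, hg'⟩
    refine ⟨fun p => ?_, fun a ha => by simp [hf' a ha, hg' a ha]⟩
    simp only [Pi.add_apply, add_mul, Finset.sum_add_distrib, hf p, hg p, add_zero]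
  smul_mem' := by
    rintro c f ⟨hf, hf'⟩
    refine ⟨fun p => ?_, fun a ha => by simp [hf' a ha]⟩
    simp only [Pi.smul_apply, smul_eq_mul, mul_assoc, ← Finset.mul_sum, hf p, mul_zero]

theorem mem_circulations {D : MultiDigraph V A} {B : Set A} {f : A → ℝ} :
    f ∈ D.circulations B ↔
      (∀ p : V → ℝ, ∑ a, f a * (p (D.head a) - p (D.tail a)) = 0) ∧ ∀ a ∉ B, f a = 0 :=
  Iff.rfl

theorem circulations_mono (D : MultiDigraph V A) {B C : Set A} (h : B ⊆ C) :
    D.circulations B ≤ D.circulations C :=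
  fun _ hf => ⟨hf.1, fun a ha => hf.2 a fun hB => ha (h hB)⟩

/-- A directed walk carries a unit flow. -/
theorem exists_flow_of_reachable (D : MultiDigraph V A) {B : Set A}
    {u v : {v : V // ∃ a ∈ B, D.tail a = v ∨ D.head a = v}} (h : (D.arcInduced B).Reachable u v) :
    ∃ f : A → ℝ, (∀ a, 0 ≤ f a) ∧ (∀ a ∉ B, f a = 0) ∧
      ∀ p : V → ℝ, ∑ a, f a * (p (D.head a) - p (D.tail a)) = p v - p u := by
  induction h with
  | refl => exact ⟨0, by simp⟩
  | tail _ hbc ih =>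
    obtain ⟨f, hf0, hfB, hf⟩ := ih
    obtain ⟨a, rfl, rfl⟩ := hbc
    refine ⟨f + Pi.single (a : A) 1, fun i => ?_, fun i hi => ?_, fun p => ?_⟩
    · have h1 : (0 : A → ℝ) ≤ Pi.single (a : A) 1 := Pi.single_nonneg.2 zero_le_one
      exact add_nonneg (hf0 i) (h1 i)
    · have hia : i ≠ a := by
        rintro rfl
        exact hi a.2
      simp [hfB i hi, hia]
    · simp only [Pi.add_apply, add_mul, Finset.sum_add_distrib, hf p]
      rw [Finset.sum_eq_single (a : A) (fun i _ hi => by simp [hi]) (by simp)]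
      simp [arcInduced]

theorem IsTotallyCyclic.exists_circulation {D : MultiDigraph V A} {B : Set A}
    (h : (D.arcInduced B).IsTotallyCyclic) : ∃ f ∈ D.circulations B, ∀ a ∈ B, 0 < f a := by
  have key : ∀ a : A, ∃ f ∈ D.circulations B, (∀ i, 0 ≤ f i) ∧ (a ∈ B → 0 < f a) := by
    intro a
    by_cases ha : a ∈ B
    · have hr := h ((D.arcInduced B).head ⟨a, ha⟩) ((D.arcInduced B).tail ⟨a, ha⟩)
        (.symm _ _ (.rel _ _ ⟨⟨a, ha⟩, rfl, rfl⟩))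
      obtain ⟨f, hf0, hfB, hf⟩ := D.exists_flow_of_reachable hr
      have h1 : (0 : A → ℝ) ≤ Pi.single a 1 := Pi.single_nonneg.2 zero_le_one
      refine ⟨f + Pi.single a 1, ⟨fun p => ?_, fun i hi => ?_⟩, fun i => ?_, fun _ => ?_⟩
      · simp only [Pi.add_apply, add_mul, Finset.sum_add_distrib, hf p]
        rw [Finset.sum_eq_single a (fun i _ hi => by simp [hi]) (by simp)]
        simp [arcInduced]
      · have hia : i ≠ a := by
          rintro rfl
          exact hi ha
        simp [hfB i hi, hia]
      · exact add_nonneg (hf0 i) (h1 i)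
      · simpa using add_pos_of_nonneg_of_pos (hf0 a) one_pos
    · exact ⟨0, Submodule.zero_mem _, fun _ => le_rfl, fun h => absurd h ha⟩
  choose F hF hF0 hFa using key
  refine ⟨∑ a, F a, Submodule.sum_mem _ fun a _ => hF a, fun a ha => ?_⟩
  rw [Finset.sum_apply]
  exact Finset.sum_pos' (fun b _ => hF0 b a) ⟨a, Finset.mem_univ a, hFa a ha⟩

/-- Let `S` be the set of vertices reachable from the head of `a`. No arc of `B` leaves `S`, so
against the indicator of `S` all terms of the circulation equation are nonnegative, hence zero. Thus
no arc of `B` enters `S` either, and the tail of `a` lies in `S`. -/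
theorem isTotallyCyclic_of_circulation {D : MultiDigraph V A} {B : Set A} {f : A → ℝ}
    (hf : f ∈ D.circulations B) (hpos : ∀ a ∈ B, 0 < f a) :
    (D.arcInduced B).IsTotallyCyclic := by
  have key : ∀ a : B, (D.arcInduced B).Reachable ((D.arcInduced B).head a)
      ((D.arcInduced B).tail a) := by
    intro a
    let S : Set V := {v | ∃ h, (D.arcInduced B).Reachable ((D.arcInduced B).head a) ⟨v, h⟩}
    have hS : ∀ b ∈ B, D.tail b ∈ S → D.head b ∈ S := by
      rintro b hb ⟨h, hr⟩
      exact ⟨⟨b, hb, Or.inr rfl⟩, hr.tail ⟨⟨b, hb⟩, rfl, rfl⟩⟩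
    let p : V → ℝ := S.indicator 1
    have hnn : ∀ b ∈ Finset.univ, 0 ≤ f b * (p (D.head b) - p (D.tail b)) := by
      intro b _
      by_cases hb : b ∈ B
      · refine mul_nonneg (hpos b hb).le ?_
        by_cases ht : D.tail b ∈ S
        · simp [p, ht, hS b hb ht]
        · simp only [p, Set.indicator_of_notMem ht, sub_zero]
          exact Set.indicator_nonneg (by simp) _
      · simp [hf.2 b hb]
    have h0 := (Finset.sum_eq_zero_iff_of_nonneg hnn).1 (hf.1 p) a (Finset.mem_univ _)
    have h1 := (mul_eq_zero.1 h0).resolve_left (hpos a a.2).ne'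
    have hh : D.head a ∈ S := ⟨⟨a, a.2, Or.inr rfl⟩, Relation.ReflTransGen.refl⟩
    have ht : D.tail a ∈ S := by
      by_contra ht
      simp [p, hh, ht] at h1
    exact ht.2
  have both : ∀ u v, (D.arcInduced B).SameComponent u v →
      (D.arcInduced B).Reachable u v ∧ (D.arcInduced B).Reachable v u := by
    intro u v h
    induction h with
    | rel u v h =>
      obtain ⟨a, rfl, rfl⟩ := h
      exact ⟨Relation.ReflTransGen.single ⟨a, rfl, rfl⟩, key a⟩
    | refl u => exact ⟨Relation.ReflTransGen.refl, Relation.ReflTransGen.refl⟩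
    | symm _ _ _ ih => exact ih.symm
    | trans _ _ _ _ _ ih₁ ih₂ => exact ⟨ih₁.1.trans ih₂.1, ih₂.2.trans ih₁.2⟩
  exact fun u v h => (both u v h).1

theorem isTotallyCyclic_iff_exists_circulation {D : MultiDigraph V A} {B : Set A} :
    (D.arcInduced B).IsTotallyCyclic ↔ ∃ f ∈ D.circulations B, ∀ a ∈ B, 0 < f a :=
  ⟨fun h => h.exists_circulation, fun ⟨_, hf, hpos⟩ => isTotallyCyclic_of_circulation hf hpos⟩

/-! ### The rank function of `Q`. -/

/-- The dimension of the space of circulations supported in a member of `Q`. -/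
noncomputable def circRank (D : MultiDigraph V A) (B : D.Q) : ℕ :=
  finrank ℝ (D.circulations B.1)

theorem circRank_strictMono (D : MultiDigraph V A) : StrictMono D.circRank := by
  intro B C hBC
  refine Submodule.finrank_lt_finrank_of_lt
    (lt_of_le_of_ne (D.circulations_mono hBC.le) fun h => ?_)
  obtain ⟨g, hg, hpos⟩ := C.2.exists_circulation
  refine hBC.not_ge fun a ha => ?_
  by_contra haB
  rw [← h] at hg
  exact (hpos a ha).ne' (hg.2 a haB)

theorem circRank_emptyQ (D : MultiDigraph V A) : D.circRank D.emptyQ = 0 := by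
  have h : D.circulations ∅ = ⊥ := by
    rw [eq_bot_iff]
    intro f hf
    ext a
    exact hf.2 a (Set.notMem_empty a)
  change finrank ℝ (D.circulations ∅) = 0
  rw [h, finrank_bot]

/-- The union of all members of `Q` carries the sum of their positive circulations. -/
theorem exists_greatest (D : MultiDigraph V A) : ∃ T : D.Q, ∀ B, B ≤ T := by
  have : Fintype D.Q := Fintype.ofFinite _
  have key : ∀ B : D.Q, ∃ f ∈ D.circulations B.1, ∀ a ∈ B.1, 0 < f a :=
    fun B => B.2.exists_circulation
  choose F hF hpos using key
  have hT : (D.arcInduced {a | ∃ B : D.Q, a ∈ B.1}).IsTotallyCyclic := by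
    have hsub : ∀ C : D.Q, C.1 ⊆ {a | ∃ B : D.Q, a ∈ B.1} := fun C a ha => ⟨C, ha⟩
    refine isTotallyCyclic_of_circulation (f := ∑ B, F B) (Submodule.sum_mem _ fun B _ =>
      D.circulations_mono (hsub B) (hF B)) ?_
    rintro a ⟨B, ha⟩
    rw [Finset.sum_apply]
    refine Finset.sum_pos' (fun C _ => ?_) ⟨B, Finset.mem_univ B, hpos B a ha⟩
    by_cases haC : a ∈ C.1
    · exact (hpos C a haC).le
    · exact ((hF C).2 a haC).ge
  exact ⟨⟨_, hT⟩, fun B a ha => ⟨B, ha⟩⟩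

/-- If a circulation supported in `C` vanishes at some arc of `C \ B` and is negative at another
one, then some member of `Q` lies strictly between `B` and `C`. -/
theorem not_covBy_of_circulation {D : MultiDigraph V A} {B C : D.Q} (hle : B ≤ C) {h : A → ℝ}
    (hh : h ∈ D.circulations C.1) {a₀ a₁ : A} (ha₀ : a₀ ∈ C.1 \ B.1) (h₀ : h a₀ = 0)
    (ha₁ : a₁ ∈ C.1 \ B.1) (h₁ : h a₁ < 0) : ¬ B ⋖ C := by
  obtain ⟨f, hf, hfpos⟩ := B.2.exists_circulation
  obtain ⟨g, hg, hgpos⟩ := C.2.exists_circulation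
  -- Ratio test: `t` is the largest multiple for which `g + t • h` stays nonnegative on `C \ B`; it
  -- vanishes at `a₂` and is positive at `a₀`.
  obtain ⟨a₂, ⟨ha₂, h₂⟩, hmin⟩ := Set.exists_min_image {a | a ∈ C.1 \ B.1 ∧ h a < 0}
    (fun a => g a / (-h a)) (Set.toFinite _) ⟨a₁, ha₁, h₁⟩
  set t := g a₂ / (-h a₂) with ht
  have ht0 : 0 < t := div_pos (hgpos a₂ ha₂.1) (neg_pos.2 h₂)
  have hk : ∀ a ∈ C.1 \ B.1, 0 ≤ g a + t * h a := by
    intro a ha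
    rcases lt_or_ge (h a) 0 with hneg | hnn
    · have := (le_div_iff₀ (neg_pos.2 hneg)).1 (hmin a ⟨ha, hneg⟩)
      linarith
    · exact add_nonneg (hgpos a ha.1).le (mul_nonneg ht0.le hnn)
  have hk₂ : g a₂ + t * h a₂ = 0 := by
    rw [ht]
    field_simp [h₂.ne]
    ring
  obtain ⟨ε, hε, hpos⟩ := PolyhedralCone.exists_pos_perturb
    (fun a : A => (LinearMap.proj a : (A → ℝ) →ₗ[ℝ] ℝ)) B.1.toFinset (x := f)
    (by simpa using hfpos) (g + t • h)
  simp only [Set.mem_toFinset, LinearMap.proj_apply] at hpos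
  set k := f + ε • (g + t • h) with hkdef
  have hkC : k ∈ D.circulations C.1 := Submodule.add_mem _ (D.circulations_mono hle hf)
    (Submodule.smul_mem _ _ (Submodule.add_mem _ hg (Submodule.smul_mem _ _ hh)))
  have hkoff : ∀ a ∉ B.1, k a = ε * (g a + t * h a) := fun a ha => by
    
    simp only [hkdef, Pi.add_apply, Pi.smul_apply, smul_eq_mul, hf.2 a ha, zero_add]
  have hknn : ∀ a, 0 ≤ k a := by
    intro a
    by_cases haB : a ∈ B.1
    · exact (hpos a haB).le
    · by_cases haC : a ∈ C.1
      · rw [hkoff a haB]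
        exact mul_nonneg hε.le (hk a ⟨haC, haB⟩)
      · exact (hkC.2 a haC).ge
  -- The support of `k` contains `B` because `ε` is small, contains `a₀ ∉ B`, and misses `a₂ ∈ C`.
  let X : D.Q := ⟨{a | 0 < k a}, isTotallyCyclic_of_circulation (f := k)
    ⟨hkC.1, fun a ha => le_antisymm (not_lt.1 ha) (hknn a)⟩ fun a ha => ha⟩
  intro hcov
  refine hcov.2 (c := X) (lt_of_le_of_ne (fun a ha => hpos a ha) ?_) (lt_of_le_of_ne ?_ ?_)
  · intro hBX
    refine ha₀.2 ?_
    rw [hBX]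
    change 0 < k a₀
    rw [hkoff a₀ ha₀.2, h₀, mul_zero, add_zero]
    exact mul_pos hε (hgpos a₀ ha₀.1)
  · intro a ha
    by_contra haC
    exact (ne_of_gt (show 0 < k a from ha)) (hkC.2 a haC)
  · intro hXC
    have h3 : a₂ ∈ X.1 := by
      rw [hXC]
      exact ha₂.1
    have h4 : 0 < k a₂ := h3
    rw [hkoff a₂ ha₂.2, hk₂, mul_zero] at h4
    exact lt_irrefl _ h4

theorem circRank_eq_add_one_of_covBy {D : MultiDigraph V A} {B C : D.Q} (hcov : B ⋖ C) :
    D.circRank C = D.circRank B + 1 := by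
  obtain ⟨g, hg, hgpos⟩ := C.2.exists_circulation
  have hnot : ¬ C.1 ⊆ B.1 := hcov.lt.not_ge
  obtain ⟨a₀, ha₀, ha₀B⟩ := Set.not_subset.1 hnot
  -- By the preceding lemma, applied to `h` or `-h`, a circulation on `C` that vanishes at the
  -- single arc `a₀` vanishes on all of `C \ B`. So the space for `B` is a hyperplane section of the
  -- one for `C`.
  have heq : D.circulations B.1 =
      D.circulations C.1 ⊓ LinearMap.ker (LinearMap.proj a₀ : (A → ℝ) →ₗ[ℝ] ℝ) := by
    refine le_antisymm (fun f hf => ⟨D.circulations_mono hcov.le hf, hf.2 a₀ ha₀B⟩) ?_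
    rintro h ⟨hh, h₀⟩
    refine ⟨hh.1, fun a ha => ?_⟩
    by_contra hne
    have haC : a ∈ C.1 := by
      by_contra haC
      exact hne (hh.2 a haC)
    rcases lt_or_gt_of_ne hne with h1 | h1
    · exact not_covBy_of_circulation hcov.le hh ⟨ha₀, ha₀B⟩ h₀ ⟨haC, ha⟩ h1 hcov
    · refine not_covBy_of_circulation hcov.le (Submodule.neg_mem _ hh) ⟨ha₀, ha₀B⟩ ?_ ⟨haC, ha⟩
        (by simpa using h1) hcov
      have : h a₀ = 0 := h₀
      simp [this]
  unfold circRank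
  rw [heq]
  exact PolyhedralCone.finrank_inf_ker_add_one hg (hgpos a₀ ha₀).ne'

/-! ### Intervals of `Q` as face lattices. -/

theorem vanishing_circulations (D : MultiDigraph V A) {B : Set A} {X : Finset A}
    (hX : (X : Set A) ⊆ B) :
    PolyhedralCone.vanishing (D.circulations B) (fun a => LinearMap.proj a) (Finset.univ \ X) =
      D.circulations X := by
  ext f
  simp only [PolyhedralCone.mem_vanishing, mem_circulations, Finset.mem_sdiff, Finset.mem_univ,
    true_and, LinearMap.proj_apply, Finset.mem_coe]
  constructor
  · rintro ⟨⟨h, -⟩, h'⟩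
    exact ⟨h, h'⟩
  · rintro ⟨h, h'⟩
    exact ⟨⟨h, fun a ha => h' a fun haX => ha (hX haX)⟩, h'⟩

/-- The faces of the cone of nonnegative circulations supported in `B` are the members of `Q`
contained in `B`. -/
theorem isFace_circulations_iff (D : MultiDigraph V A) {B : Set A} {X : Finset A} :
    PolyhedralCone.IsFace (D.circulations B) (fun a => LinearMap.proj a) Finset.univ X ↔
      (X : Set A) ⊆ B ∧ (D.arcInduced (X : Set A)).IsTotallyCyclic := by
  rw [isTotallyCyclic_iff_exists_circulation]
  unfold PolyhedralCone.IsFace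
  constructor
  · rintro ⟨f, hf, hpos⟩
    have hX : (X : Set A) ⊆ B := fun a ha => by
      by_contra haB
      exact (hpos a ha).ne' ((PolyhedralCone.mem_vanishing.1 hf).1.2 a haB)
    rw [D.vanishing_circulations hX] at hf
    exact ⟨hX, f, hf, hpos⟩
  · rintro ⟨hX, f, hf, hpos⟩
    rw [← D.vanishing_circulations hX] at hf
    exact ⟨f, hf, hpos⟩

/-- This is the Euler relation for the cone of nonnegative circulations on `B`, which is not a
linear subspace because a positive circulation on the nonempty set `B` exists. Constraints at arcs
outside `B` are always tight and add no faces. -/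
theorem sum_Icc_circRank (D : MultiDigraph V A) {B : D.Q} (hB : B ≠ D.emptyQ) :
    ∑ X ∈ Finset.Icc D.emptyQ B, (-1 : ℤ) ^ D.circRank X = 0 := by
  obtain ⟨g, hg, hgpos⟩ := B.2.exists_circulation
  obtain ⟨b, hb⟩ : B.1.Nonempty := by
    rw [Set.nonempty_iff_ne_empty]
    exact fun h => hB (Subtype.ext h)
  have hE := PolyhedralCone.eulerSum_eq_zero Finset.univ (D.circulations B.1)
    (fun a => (LinearMap.proj a : (A → ℝ) →ₗ[ℝ] ℝ))
    ⟨g, hg, fun a _ => by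
      by_cases ha : a ∈ B.1
      · exact (hgpos a ha).le
      · exact (hg.2 a ha).ge, b, Finset.mem_univ b, hgpos b hb⟩
  rw [← hE, PolyhedralCone.eulerSum, ← Finset.sum_filter]
  refine Finset.sum_bij (fun X _ => X.1.toFinset) ?_ ?_ ?_ ?_
  · intro X hX
    rw [Finset.mem_filter, isFace_circulations_iff, Set.coe_toFinset]
    exact ⟨by simp, (Finset.mem_Icc.1 hX).2, X.2⟩
  · intro X _ Y _ h
    exact Subtype.ext (Set.toFinset_inj.1 h)
  · intro X hX
    rw [Finset.mem_filter, isFace_circulations_iff] at hX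
    exact ⟨⟨X, hX.2.2⟩, Finset.mem_Icc.2 ⟨D.emptyQ_le _, hX.2.1⟩, by simp⟩
  · intro X hX
    have hXB : (X.1.toFinset : Set A) ⊆ B.1 := by
      rw [Set.coe_toFinset]
      exact (Finset.mem_Icc.1 hX).2
    rw [D.vanishing_circulations hXB, Set.coe_toFinset]
    rfl

/-- `Q` is graded by the dimension of the circulation space. -/
noncomputable abbrev gradeMinOrderQ (D : MultiDigraph V A) : GradeMinOrder ℕ D.Q where
  grade := D.circRank
  grade_strictMono := D.circRank_strictMono
  covBy_grade _ _ h := by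
    rw [Nat.covBy_iff_add_one_eq, circRank_eq_add_one_of_covBy h]
  isMin_grade B hB := by
    have : B = D.emptyQ := le_antisymm (hB (D.emptyQ_le B)) (D.emptyQ_le B)
    rw [this, circRank_emptyQ]
    exact isMin_bot

end MultiDigraph

theorem mainTheorem2 {V A : Type*} [Finite V] [Finite A] (D : MultiDigraph V A) :
    (∃ n : ℕ, ∀ c : Set D.Q, IsMaxChain (· ≤ ·) c → c.ncard = n + 1) ∧
      ∃ _rk : GradeMinOrder ℕ D.Q,
        ∀ B : D.Q, IncidenceAlgebra.mu ℤ D.emptyQ B = (-1) ^ grade ℕ B := by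
  have : Fintype A := Fintype.ofFinite A
  obtain ⟨T, hT⟩ := D.exists_greatest
  refine ⟨⟨D.circRank T, fun c hc => hc.ncard_eq_of_covBy D.circRank_strictMono
    (fun _ _ => MultiDigraph.circRank_eq_add_one_of_covBy) D.emptyQ_le hT D.circRank_emptyQ⟩,
    D.gradeMinOrderQ, ?_⟩
  exact IncidenceAlgebra.mu_eq_of_sum_Icc_eq_zero D.emptyQ_le
    (s := fun B => (-1) ^ D.circRank B) (by simp [D.circRank_emptyQ])
    fun B hB => D.sum_Icc_circRank hB
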